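/- There exist an absolute constant $c>0$ and a real-valued function $\delta(q,x)$ such that $\delta(q,x)\to 0$ as both $\frac{\log q}{\log x}\to\infty$ and $\frac{\log x}{\sqrt{\log q\,\log\log q}}\to\infty$ (where $q\ge 3$ is an integer and $x>1$ is real; that is, for every $\varepsilon>0$ there is an $M$ such that $|\delta(q,x)|\le\varepsilon$ whenever both quotients are at least $M$), and such that the following holds. There is a constant $M_0$ such that for every integer $q\ge 3$ and every real $x>1$ for which both $\frac{\log q}{\log x}\ge M_0$ and $\frac{\log x}{\sqrt{\log q\,\log\log q}}\ge M_0$, there exists a non-principal Dirichlet character $\chi \pmod q$ with $$ \frac{1}{\sqrt{x}}\,\biggl|\sum_{n\le x}\chi(n)\biggr| \;\ge\; c\,\biggl(\frac{\log x}{\sqrt{\log q\,\log\log q}}\biggr)^{(1+\delta(q,x))\frac{\log q}{\log x}} . $$ -/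

import Mathlib

/-- The quotient `log x / √(log q · log log q)`. -/
noncomputable def theoremBase (q : ℕ) (x : ℝ) : ℝ :=
  Real.log x / Real.sqrt (Real.log q * Real.log (Real.log q))

/-- The limiting regime for pairs `(q, x)`, `q` a natural number and `x > 0` real, in which both
`log q / log x → ∞` and `log x / √(log q · log log q) → ∞`. A property holds eventually along this
filter iff there is `M` such that it holds for all `q` and all `x > 0` for which both quotients are
at least `M`. -/
noncomputable def largeRegime : Filter (ℕ × ℝ) :=
  Filter.comap (fun p : ℕ × ℝ => Real.log p.1 / Real.log p.2) Filter.atTop ⊓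
    Filter.comap (fun p : ℕ × ℝ => theoremBase p.1 p.2) Filter.atTop ⊓
    Filter.principal {p : ℕ × ℝ | 0 < p.2}

/-- The character sum `∑_{n ≤ x} χ(n)` over positive integers `n`. -/
noncomputable def charSum {q : ℕ} (χ : DirichletCharacter ℂ q) (x : ℝ) : ℂ :=
  ∑ n ∈ Finset.Icc 1 ⌊x⌋₊, χ (n : ZMod q)

/-! The resonance method. Write `L = log q / log x`, `ℓ = log log q`, `u = theoremBase q x`, and let
`S(χ)` be the character sum. For a set `A` of integers below `q` and prime to `q`, put `R(χ) = ∑_{a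
∈ A} χ(a)`. By orthogonality `∑ |R|² = φ(q) #A`, while `∑ |S R|²` is at least `φ(q)` times the
number of solutions of `m a = n b` with `m, n ≤ x` prime to `q` and `a, b ∈ A`. If `|S(χ)|² ≤ V` for
all `χ ≠ 1`, there are thus at most `V + x² #A / φ(q)` solutions per element of `A`
(`totient_mul_card_le_of_sum_le`).

Let `A` consist of the products of `J` primes from each of `W` blocks. Exchanging `j` primes of `a`
in every block for `j` others, and multiplying both exchanged products by a common prime `e`,
produces solutions (`card_le_card_solutions`). The primes in a block are so dense that each `a` has
at least about `x (J / (16 H j²)) ^ (j W) / log x` of them (`swap_count_ge`,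
`exists_lt_normSq_sum`).

The parameters keep `A` below `q ^ (1/4)`, so that the principal character contributes at most `x`,
and make `j W ≥ 2 L` and `J / (16 H j²) ≥ u ^ (3/2)`. The count is then at least `x u ^ (3 L) / (32
log x)`, which exceeds `x (u ^ (2 L) + 1)`, so some `|S(χ)|` is at least `u ^ L √x`. -/

/-- The primes in `(4 ^ s, 4 ^ (s + 1)]` that do not divide `q`. -/
def primeBlock (q s : ℕ) : Finset ℕ :=
  (Finset.Ioc (4 ^ s) (4 ^ (s + 1))).filter fun p => p.Prime ∧ ¬ p ∣ q

/-! ### Binomial coefficients, primes in blocks, and a totient bound. -/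

/-- Induction by the absorption identity; replacing `m` by `m + 1` in a `k`-th power costs at most
`((k + 1) / k) ^ k`, because `(m + 1) / m ≤ (k + 1) / k` for `k ≤ m`. -/
theorem pow_le_pow_mul_choose {n k : ℕ} (h : k ≤ n) : n ^ k ≤ k ^ k * n.choose k := by
  induction k generalizing n with
  | zero => simp
  | succ k ih =>
    obtain ⟨m, rfl⟩ : ∃ m, n = m + 1 := ⟨n - 1, by omega⟩
    have hk : k ≤ m := by omega
    rcases Nat.eq_zero_or_pos k with rfl | hk0
    · simp
    have h1 := ih hk
    have h2 : (m + 1) * m.choose k = (m + 1).choose (k + 1) * (k + 1) :=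
      Nat.add_one_mul_choose_eq m k
    have h3 : (m + 1) * k ≤ (k + 1) * m := by nlinarith
    have h4 : (m + 1) ^ k * k ^ k ≤ (k + 1) ^ k * m ^ k := by
      rw [← mul_pow, ← mul_pow]; exact Nat.pow_le_pow_left h3 k
    have h5 : (m + 1) ^ k ≤ (k + 1) ^ k * m.choose k := by
      have : k ^ k * (m + 1) ^ k ≤ k ^ k * ((k + 1) ^ k * m.choose k) := by
        calc k ^ k * (m + 1) ^ k = (m + 1) ^ k * k ^ k := by ring
          _ ≤ (k + 1) ^ k * m ^ k := h4
          _ ≤ (k + 1) ^ k * (k ^ k * m.choose k) := by gcongr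
          _ = _ := by ring
      exact Nat.le_of_mul_le_mul_left this (by positivity)
    calc (m + 1) ^ (k + 1) = (m + 1) * (m + 1) ^ k := by ring
      _ ≤ (m + 1) * ((k + 1) ^ k * m.choose k) := by gcongr
      _ = (k + 1) ^ k * ((m + 1) * m.choose k) := by ring
      _ = (k + 1) ^ (k + 1) * (m + 1).choose (k + 1) := by rw [h2]; ring

theorem two_pow_card_primeFactors_le {q : ℕ} (hq : q ≠ 0) : 2 ^ q.primeFactors.card ≤ q := by
  calc 2 ^ q.primeFactors.card ≤ ∏ p ∈ q.primeFactors, p :=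
        Finset.pow_card_le_prod _ _ _ fun p hp => (Nat.prime_of_mem_primeFactors hp).two_le
    _ ≤ q := Nat.le_of_dvd (Nat.pos_of_ne_zero hq) (Nat.prod_primeFactors_dvd q)

theorem card_primeFactors_mul_log_two_le {q : ℕ} (hq : q ≠ 0) :
    (q.primeFactors.card : ℝ) * Real.log 2 ≤ Real.log q := by
  rw [← Real.log_pow]
  refine Real.log_le_log (by positivity) ?_
  exact_mod_cast two_pow_card_primeFactors_le hq

theorem linear_le_two_pow {s : ℕ} (hs : 8 ≤ s) : 20 * (s + 2) ≤ 2 ^ s := by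
  induction s, hs using Nat.le_induction with
  | base => norm_num
  | succ n hn ih => rw [pow_succ]; omega

/-- Chebyshev's bounds give `θ(4 ^ (s + 1)) ≥ 4 ^ (s + 1) log 2 - error` and `θ(4 ^ s) ≤ 4 ^ s · 2
log 2`. The ratio `4` between endpoints leaves a main term `2 log 2 · 4 ^ s`, and the surplus of `2
log 2` over `1` absorbs the error once `s ≥ 8`. -/
theorem four_pow_le_card_primes_mul {s : ℕ} (hs : 8 ≤ s) :
    (4 : ℝ) ^ s ≤ (((Finset.Ioc (4 ^ s) (4 ^ (s + 1))).filter Nat.Prime).card : ℝ) *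
      ((s + 1) * Real.log 4) := by
  have hlog4 : Real.log 4 = 2 * Real.log 2 := by
    rw [show (4 : ℝ) = 2 ^ 2 by norm_num, Real.log_pow]; norm_num
  have hl2 := Real.log_two_gt_d9
  have hl2' := Real.log_two_lt_d9
  have hup := Chebyshev.theta_le_log4_mul_x (x := ((4 ^ s : ℕ) : ℝ)) (by positivity)
  have hlow := Chebyshev.theta_ge (4 ^ (s + 1))
  have hle : (4 : ℕ) ^ s ≤ 4 ^ (s + 1) := Nat.pow_le_pow_right (by norm_num) (by omega)
  have hdiff : Chebyshev.theta ((4 ^ (s + 1) : ℕ) : ℝ) = Chebyshev.theta ((4 ^ s : ℕ) : ℝ) +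
      ∑ p ∈ (Finset.Ioc (4 ^ s) (4 ^ (s + 1))).filter Nat.Prime, Real.log p := by
    unfold Chebyshev.theta
    rw [Nat.floor_natCast, Nat.floor_natCast, ← Finset.sum_union]
    · rw [← Finset.filter_union, Finset.Ioc_union_Ioc_eq_Ioc (Nat.zero_le _) hle]
    · refine Finset.disjoint_filter_filter ?_
      rw [Finset.disjoint_left]
      intro a ha hb
      simp only [Finset.mem_Ioc] at ha hb
      omega
  have hsum : ∑ p ∈ (Finset.Ioc (4 ^ s) (4 ^ (s + 1))).filter Nat.Prime, Real.log (p : ℝ) ≤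
      (((Finset.Ioc (4 ^ s) (4 ^ (s + 1))).filter Nat.Prime).card : ℝ) *
      ((s + 1) * Real.log 4) := by
    rw [← nsmul_eq_mul]
    refine Finset.sum_le_card_nsmul _ _ _ fun p hp => ?_
    simp only [Finset.mem_filter, Finset.mem_Ioc] at hp
    have : Real.log (p : ℝ) ≤ Real.log ((4 : ℝ) ^ (s + 1)) :=
      Real.log_le_log (by exact_mod_cast hp.2.pos) (by exact_mod_cast hp.1.2)
    rw [Real.log_pow] at this
    push_cast at this
    exact this
  have hsqrt : √((4 ^ (s + 1) : ℕ) : ℝ) = 2 ^ (s + 1) := by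
    rw [show ((4 ^ (s + 1) : ℕ) : ℝ) = (2 ^ (s + 1)) ^ 2 by
      push_cast; rw [← pow_mul, mul_comm, pow_mul]; norm_num]
    exact Real.sqrt_sq (by positivity)
  have hlog1 : Real.log (((4 ^ (s + 1) : ℕ) : ℝ) + 1) ≤ (s + 2) * Real.log 4 := by
    have h1 : ((4 ^ (s + 1) : ℕ) : ℝ) + 1 ≤ 4 ^ (s + 2) := by
      push_cast
      have : (1 : ℝ) ≤ 4 ^ (s + 1) := one_le_pow₀ (by norm_num)
      rw [pow_succ 4 (s + 1)]; linarith
    calc _ ≤ Real.log ((4 : ℝ) ^ (s + 2)) := Real.log_le_log (by positivity) h1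
      _ = _ := by rw [Real.log_pow]; push_cast; ring
  have hlog2 : Real.log ((4 ^ (s + 1) : ℕ) : ℝ) = (s + 1) * Real.log 4 := by
    push_cast; rw [Real.log_pow]; push_cast; ring
  rw [hsqrt, hlog2] at hlow
  push_cast at hlow hup hdiff hlog1
  have h20 : (20 : ℝ) * (s + 2) ≤ 2 ^ s := by exact_mod_cast linear_le_two_pow hs
  have h4 : (4 : ℝ) ^ s = 2 ^ s * 2 ^ s := by rw [← mul_pow]; norm_num
  set t : ℝ := 2 ^ s with ht
  have hs0 : (0 : ℝ) ≤ s := Nat.cast_nonneg s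
  rw [pow_succ, h4, hlog4] at hlow
  rw [pow_succ (2 : ℝ) s, ← ht] at hlow
  rw [h4, hlog4] at hup
  rw [hlog4] at hlog1 hsum
  rw [hlog4, h4]
  rw [pow_succ (4 : ℝ) s, h4] at hlog1 hdiff
  refine le_trans ?_ hsum
  rw [← sub_eq_iff_eq_add'.2 hdiff]
  have hb : (s + 2) * (2 * Real.log 2) ≤ 2 * (s + 2) := by nlinarith
  have hc : 2 * (t * 2) * ((s + 1) * (2 * Real.log 2)) ≤ 8 * (t * (s + 2)) * 0.7 := by
    have : (s + 1) * (2 * Real.log 2) ≤ (s + 2) * 1.4 := by nlinarith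
    have ht0 : 0 < t := by positivity
    nlinarith
  have ht1 : 160 ≤ t := by nlinarith [show (8 : ℝ) ≤ s by exact_mod_cast hs]
  have hd : t * (s + 2) * 20 ≤ t * t := by nlinarith
  have he : 2 * (t * t) * 0.69 ≤ 2 * (t * t) * Real.log 2 := by
    gcongr; linarith
  nlinarith

/-- Discarding the prime divisors of `q` is harmless: there are at most `log q / log 2 ≤ 2 ^ s / log
2` of them, against roughly `4 ^ s / s` primes. -/
theorem primeBlock_card {q s : ℕ} (hq : q ≠ 0) (hs : 8 ≤ s) (hlog : Real.log q ≤ 2 ^ s) :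
    (4 : ℝ) ^ s / (2 * (s + 1)) ≤ ((primeBlock q s).card : ℝ) ∧
      2 ^ (s + 1) ≤ (primeBlock q s).card := by
  have hmain := four_pow_le_card_primes_mul hs
  have hω := card_primeFactors_mul_log_two_le hq
  have hsub : ((Finset.Ioc (4 ^ s) (4 ^ (s + 1))).filter Nat.Prime).card ≤
      (primeBlock q s).card + q.primeFactors.card := by
    refine le_trans (Finset.card_le_card ?_) (Finset.card_union_le _ _)
    intro p hp
    simp only [Finset.mem_filter, Finset.mem_union, primeBlock, Nat.mem_primeFactors] at hp ⊢
    by_cases hpq : p ∣ q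
    · exact Or.inr ⟨hp.2, hpq, hq⟩
    · exact Or.inl ⟨hp.1, hp.2, hpq⟩
  have hsub' : (((Finset.Ioc (4 ^ s) (4 ^ (s + 1))).filter Nat.Prime).card : ℝ) ≤
      (primeBlock q s).card + q.primeFactors.card := by exact_mod_cast hsub
  have hlog4 : Real.log 4 = 2 * Real.log 2 := by
    rw [show (4 : ℝ) = 2 ^ 2 by norm_num, Real.log_pow]; norm_num
  have hl2 := Real.log_two_gt_d9
  have hl2' := Real.log_two_lt_d9
  have h20 : (20 : ℝ) * (s + 2) ≤ 2 ^ s := by exact_mod_cast linear_le_two_pow hs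
  have h4 : (4 : ℝ) ^ s = 2 ^ s * 2 ^ s := by rw [← mul_pow]; norm_num
  have hs0 : (0 : ℝ) ≤ s := Nat.cast_nonneg s
  rw [hlog4] at hmain
  have hfirst : (4 : ℝ) ^ s / (2 * (s + 1)) ≤ ((primeBlock q s).card : ℝ) := by
    rw [div_le_iff₀ (by positivity)]
    rw [h4] at hmain ⊢
    set t : ℝ := 2 ^ s
    have ht0 : 0 < t := by positivity
    set B : ℝ := ((primeBlock q s).card : ℝ)
    set w : ℝ := (q.primeFactors.card : ℝ)
    have hB : 0 ≤ B := Nat.cast_nonneg _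
    have hw : w * Real.log 2 ≤ t := hω.trans hlog
    have h1 : t * t ≤ (B + w) * ((s + 1) * (2 * Real.log 2)) := by
      refine hmain.trans ?_; gcongr
    have h2 : (B + w) * ((s + 1) * (2 * Real.log 2)) =
        B * (s + 1) * (2 * Real.log 2) + 2 * (s + 1) * (w * Real.log 2) := by ring
    have h3 : B * (s + 1) * (2 * Real.log 2) ≤ B * (s + 1) * 1.4 := by
      gcongr; linarith
    have h4 : 2 * (s + 1) * (w * Real.log 2) ≤ 2 * (s + 1) * t := by gcongr
    have h5 : 20 * (s + 2) * t ≤ t * t := by gcongr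
    nlinarith [mul_nonneg hB (by linarith : (0 : ℝ) ≤ s + 1)]
  refine ⟨hfirst, ?_⟩
  have : (2 : ℝ) ^ (s + 1) ≤ ((primeBlock q s).card : ℝ) := by
    refine le_trans ?_ hfirst
    rw [le_div_iff₀ (by positivity), h4, pow_succ]
    have : (0 : ℝ) < 2 ^ s := by positivity
    nlinarith
  exact_mod_cast this

/-- Serves as `φ(q) ≥ √(q / 2)`. On prime powers `p ≤ (p - 1) ^ 2` fails only for `p = 2`. -/
theorem le_two_mul_totient_sq (n : ℕ) : n ≤ 2 * n.totient ^ 2 := by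
  have hpow : ∀ p k : ℕ, p.Prime → 0 < k → p ^ k ≤ (if p = 2 then 2 else 1) * (p ^ k).totient ^ 2 := by
    intro p k hp hk
    obtain ⟨k, rfl⟩ : ∃ m, k = m + 1 := ⟨k - 1, by omega⟩
    rw [Nat.totient_prime_pow_succ hp, mul_pow, pow_succ p k]
    have h1 : p ^ k ≤ (p ^ k) ^ 2 := Nat.le_self_pow (by norm_num) _
    have h2 : p ≤ (if p = 2 then 2 else 1) * (p - 1) ^ 2 := by
      split_ifs with h
      · subst h; norm_num
      · obtain ⟨m, rfl⟩ : ∃ m, p = m + 3 := ⟨p - 3, by have := hp.two_le; omega⟩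
        have : m + 3 - 1 = m + 2 := by omega
        rw [this]; nlinarith
    calc p ^ k * p ≤ (p ^ k) ^ 2 * ((if p = 2 then 2 else 1) * (p - 1) ^ 2) := by gcongr
      _ = _ := by ring
  -- Tying the factor `2` to `2 ∣ n` makes the bound multiplicative, since at most one of two
  -- coprime factors is even.
  have key : ∀ n : ℕ, n ≤ (if 2 ∣ n then 2 else 1) * n.totient ^ 2 := by
    intro n
    induction n using Nat.recOnPosPrimePosCoprime with
    | prime_pow p k hp hk =>
      refine (hpow p k hp hk).trans ?_
      gcongr
      by_cases h : p = 2
      · subst h; simp [dvd_pow_self 2 hk.ne']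
      · rw [if_neg h]; split_ifs <;> norm_num
    | zero => simp
    | one => simp
    | coprime a b ha hb hab iha ihb =>
      rw [Nat.totient_mul hab]
      have hc : (if 2 ∣ a then 2 else 1) * (if 2 ∣ b then 2 else 1) ≤
          (if 2 ∣ a * b then 2 else 1) := by
        by_cases h2a : 2 ∣ a
        · have : ¬ 2 ∣ b := fun h2b => by
            have := Nat.dvd_gcd h2a h2b
            rw [hab] at this; omega
          simp [h2a, this, Dvd.dvd.mul_right h2a]
        · by_cases h2b : 2 ∣ b
          · simp [h2a, h2b, Dvd.dvd.mul_left h2b]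
          · simp only [h2a, h2b, if_false]; split_ifs <;> norm_num
      calc a * b ≤ ((if 2 ∣ a then 2 else 1) * a.totient ^ 2) *
            ((if 2 ∣ b then 2 else 1) * b.totient ^ 2) := Nat.mul_le_mul iha ihb
        _ = ((if 2 ∣ a then 2 else 1) * (if 2 ∣ b then 2 else 1)) *
            (a.totient * b.totient) ^ 2 := by ring
        _ ≤ _ := by gcongr
  refine (key n).trans ?_
  gcongr
  split_ifs <;> norm_num

/-! ### Orthogonality and the resonance inequality. -/

open Finset in
/-- Orthogonality of Dirichlet characters for a second moment. -/
theorem sum_normSq_sum_dirichletCharacter {q : ℕ} [NeZero q] {ι : Type*} (I : Finset ι)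
    (f : ι → ZMod q) [DecidablePred fun p : ι × ι => f p.1 = f p.2]
    (hf : ∀ i ∈ I, IsUnit (f i)) :
    ∑ χ : DirichletCharacter ℂ q, ‖∑ i ∈ I, χ (f i)‖ ^ 2 =
      q.totient * (((I ×ˢ I).filter fun p => f p.1 = f p.2).card : ℝ) := by
  have hC : ((∑ χ : DirichletCharacter ℂ q, ‖∑ i ∈ I, χ (f i)‖ ^ 2 : ℝ) : ℂ) =
      q.totient * (((I ×ˢ I).filter fun p => f p.1 = f p.2).card : ℂ) := by
    push_cast
    have hexp : ∀ χ : DirichletCharacter ℂ q, ((‖∑ i ∈ I, χ (f i)‖ : ℂ)) ^ 2 =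
        ∑ i ∈ I, ∑ k ∈ I, χ (f i)⁻¹ * χ (f k) := by
      intro χ
      rw [← Complex.conj_mul', map_sum, Finset.sum_mul_sum]
      refine Finset.sum_congr rfl fun i hi => Finset.sum_congr rfl fun k _ => ?_
      congr 1
      have h1 := MulChar.star_apply' χ (f i)
      rw [MulChar.inv_apply] at h1
      obtain ⟨u, hu⟩ := hf i hi
      rw [← hu] at h1 ⊢
      rw [Ring.inverse_unit] at h1
      rw [ZMod.inv_coe_unit]
      exact h1
    simp_rw [hexp]
    rw [Finset.sum_comm]
    have : ∀ i ∈ I, ∑ χ : DirichletCharacter ℂ q, ∑ k ∈ I, χ (f i)⁻¹ * χ (f k) =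
        ∑ k ∈ I, if f i = f k then (q.totient : ℂ) else 0 := by
      intro i hi
      rw [Finset.sum_comm]
      exact Finset.sum_congr rfl fun k _ =>
        DirichletCharacter.sum_char_inv_mul_char_eq ℂ (hf i hi) (f k)
    rw [Finset.sum_congr rfl this, ← Finset.sum_product', Finset.card_filter, Nat.cast_sum,
      Finset.mul_sum]
    refine Finset.sum_congr rfl fun p _ => ?_
    split_ifs <;> simp
  exact_mod_cast hC

open Finset in
/-- The resonance inequality: if all non-principal character sums up to `N` are at most `√V`, then
the number of solutions of `m a = n b` with `m, n ≤ N` prime to `q` and `a, b` in a set `A` of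
integers prime to `q` and below `q` is at most `V #A + N ^ 2 (#A) ^ 2 / φ(q)`. -/
theorem totient_mul_card_le_of_sum_le {q : ℕ} [NeZero q] (N : ℕ) (A : Finset ℕ)
    (hA : ∀ a ∈ A, a.Coprime q ∧ a < q) {V : ℝ} (hV0 : 0 ≤ V)
    (hV : ∀ χ : DirichletCharacter ℂ q, χ ≠ 1 →
      ‖∑ n ∈ Icc 1 N, χ (n : ZMod q)‖ ^ 2 ≤ V) :
    (q.totient : ℝ) * (((((Icc 1 N).filter (Nat.Coprime · q) ×ˢ A) ×ˢ
      ((Icc 1 N).filter (Nat.Coprime · q) ×ˢ A)).filter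
        fun p => p.1.1 * p.1.2 = p.2.1 * p.2.2).card : ℝ) ≤
      V * (q.totient * A.card) + (N : ℝ) ^ 2 * (A.card : ℝ) ^ 2 := by
  classical
  set I : Finset ℕ := (Icc 1 N).filter (Nat.Coprime · q) with hI
  have hunit : ∀ i ∈ I ×ˢ A, IsUnit (((i.1 * i.2 : ℕ) : ZMod q)) := by
    intro i hi
    rw [mem_product, hI, mem_filter] at hi
    rw [ZMod.isUnit_iff_coprime]
    exact Nat.Coprime.mul_left hi.1.2 (hA _ hi.2).1
  have hmom := sum_normSq_sum_dirichletCharacter (I ×ˢ A) (fun i => ((i.1 * i.2 : ℕ) : ZMod q)) hunit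
  have hmomA := sum_normSq_sum_dirichletCharacter A (fun a => (a : ZMod q))
    (fun a ha => (ZMod.isUnit_iff_coprime a q).2 (hA a ha).1)
  -- Elements of `A` are below `q`, so congruence modulo `q` is equality.
  have hdiag : ((A ×ˢ A).filter fun p : ℕ × ℕ => (p.1 : ZMod q) = p.2).card = A.card := by
    rw [← A.diag_card]
    congr 1
    ext ⟨a, b⟩
    simp only [mem_filter, mem_product, mem_diag]
    constructor
    · rintro ⟨⟨ha, hb⟩, hab⟩
      refine ⟨ha, ?_⟩
      rw [ZMod.natCast_eq_natCast_iff'] at hab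
      rwa [Nat.mod_eq_of_lt (hA a ha).2, Nat.mod_eq_of_lt (hA b hb).2] at hab
    · rintro ⟨ha, rfl⟩
      exact ⟨⟨ha, ha⟩, rfl⟩
  rw [hdiag] at hmomA
  have hfac : ∀ χ : DirichletCharacter ℂ q, ∑ i ∈ I ×ˢ A, χ ((i.1 * i.2 : ℕ) : ZMod q) =
      (∑ n ∈ Icc 1 N, χ (n : ZMod q)) * ∑ a ∈ A, χ (a : ZMod q) := by
    intro χ
    have : ∑ n ∈ Icc 1 N, χ (n : ZMod q) = ∑ n ∈ I, χ (n : ZMod q) := by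
      rw [hI, sum_filter]
      refine sum_congr rfl fun n _ => ?_
      split_ifs with h
      · rfl
      · exact χ.map_nonunit (fun hu => h ((ZMod.isUnit_iff_coprime n q).1 hu))
    rw [this, sum_mul_sum, sum_product]
    simp
  -- Only a lower bound is needed here, so solutions that hold merely modulo `q` are dropped.
  have hcount : (((((I ×ˢ A) ×ˢ (I ×ˢ A)).filter
        fun p => p.1.1 * p.1.2 = p.2.1 * p.2.2).card : ℕ) : ℝ) ≤
      (((I ×ˢ A) ×ˢ (I ×ˢ A)).filter fun p : (ℕ × ℕ) × ℕ × ℕ =>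
        ((p.1.1 * p.1.2 : ℕ) : ZMod q) = ((p.2.1 * p.2.2 : ℕ) : ZMod q)).card := by
    refine Nat.cast_le.2 (card_le_card (monotone_filter_right _ ?_))
    intro p _ hp
    exact congrArg _ hp
  calc _ ≤ ∑ χ : DirichletCharacter ℂ q, ‖∑ i ∈ I ×ˢ A, χ ((i.1 * i.2 : ℕ) : ZMod q)‖ ^ 2 := by
        rw [hmom]; gcongr
    _ ≤ ∑ χ : DirichletCharacter ℂ q, (V * ‖∑ a ∈ A, χ (a : ZMod q)‖ ^ 2 +
          if χ = 1 then (N : ℝ) ^ 2 * (A.card : ℝ) ^ 2 else 0) := by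
        refine sum_le_sum fun χ _ => ?_
        rw [hfac, norm_mul, mul_pow]
        split_ifs with h
        · refine le_trans ?_ (le_add_of_nonneg_left (by positivity))
          gcongr
          · refine (norm_sum_le _ _).trans ?_
            refine (sum_le_card_nsmul _ _ 1 fun n _ => DirichletCharacter.norm_le_one χ _).trans ?_
            simp
          · refine (norm_sum_le _ _).trans ?_
            refine (sum_le_card_nsmul _ _ 1 fun n _ => DirichletCharacter.norm_le_one χ _).trans ?_
            simp
        · rw [add_zero]
          gcongr
          exact hV χ h
    _ = _ := by
        rw [sum_add_distrib, ← mul_sum, hmomA]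
        simp

/-! ### Solutions of `m a = n b` from exchanges of primes. -/

open Finset in
theorem prod_prod_eq_prod_biUnion {ι : Type*} [Fintype ι] {Q : ι → Finset ℕ}
    (hdisj : Pairwise fun i k => Disjoint (Q i) (Q k)) {a : ι → Finset ℕ} (ha : ∀ i, a i ⊆ Q i) :
    ∏ i, ∏ p ∈ a i, p = ∏ p ∈ univ.biUnion a, p := by
  rw [prod_biUnion]
  intro i _ k _ hik
  exact disjoint_of_subset_left (ha i) (disjoint_of_subset_right (ha k) (hdisj hik))

open Finset in
/-- A family of subsets of disjoint sets of primes is determined by the product of its elements. -/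
theorem eq_of_prod_prod_eq {ι : Type*} [Fintype ι] {Q : ι → Finset ℕ}
    (hprime : ∀ i, ∀ p ∈ Q i, p.Prime) (hdisj : Pairwise fun i k => Disjoint (Q i) (Q k))
    {a b : ι → Finset ℕ} (ha : ∀ i, a i ⊆ Q i) (hb : ∀ i, b i ⊆ Q i)
    (h : ∏ i, ∏ p ∈ a i, p = ∏ i, ∏ p ∈ b i, p) : a = b := by
  have hU : ∀ c : ι → Finset ℕ, (∀ i, c i ⊆ Q i) →
      (∏ i, ∏ p ∈ c i, p).primeFactors = univ.biUnion c := by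
    intro c hc
    rw [prod_prod_eq_prod_biUnion hdisj hc]
    refine Nat.primeFactors_prod fun p hp => ?_
    obtain ⟨i, _, hi⟩ := mem_biUnion.1 hp
    exact hprime i p (hc i hi)
  have hmem : ∀ c : ι → Finset ℕ, (∀ i, c i ⊆ Q i) → ∀ i p, p ∈ c i ↔
      p ∈ Q i ∧ p ∈ (∏ i, ∏ p ∈ c i, p).primeFactors := by
    intro c hc i p
    rw [hU c hc, mem_biUnion]
    refine ⟨fun hp => ⟨hc i hp, i, mem_univ _, hp⟩, ?_⟩
    rintro ⟨hp, k, _, hk⟩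
    by_cases hik : i = k
    · exact hik ▸ hk
    · exact absurd (hc k hk) (disjoint_left.1 (hdisj hik) hp)
  funext i
  ext p
  rw [hmem a ha, hmem b hb, h]

open Finset in
/-- Count of the solutions of `m a = n b` obtained by exchanging `j` primes in each of several
blocks. -/
theorem card_le_card_solutions {ι : Type*} [Fintype ι] [DecidableEq ι] {q N J j X : ℕ}
    {Q : ι → Finset ℕ} {U : ι → ℕ} {E : Finset ℕ}
    (hprime : ∀ i, ∀ p ∈ Q i, p.Prime) (hdisj : Pairwise fun i k => Disjoint (Q i) (Q k))
    (hcop : ∀ i, ∀ p ∈ Q i, p.Coprime q) (hU : ∀ i, ∀ p ∈ Q i, p ≤ U i)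
    (hE : ∀ e ∈ E, 0 < e ∧ e.Coprime q ∧ e ≤ X) (hN : X * ∏ i, U i ^ j ≤ N) :
    (Fintype.piFinset fun i => (Q i).powersetCard J).card *
        ((∏ i, J.choose j * ((Q i).card - J).choose j) * E.card) ≤
      ((((Icc 1 N).filter (Nat.Coprime · q) ×ˢ
          (Fintype.piFinset fun i => (Q i).powersetCard J).image fun a => ∏ i, ∏ p ∈ a i, p) ×ˢ
        ((Icc 1 N).filter (Nat.Coprime · q) ×ˢ
          (Fintype.piFinset fun i => (Q i).powersetCard J).image fun a => ∏ i, ∏ p ∈ a i, p)).filter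
        fun p => p.1.1 * p.1.2 = p.2.1 * p.2.2).card := by
  set F := Fintype.piFinset fun i => (Q i).powersetCard J with hF
  set val : (ι → Finset ℕ) → ℕ := fun a => ∏ i, ∏ p ∈ a i, p with hval
  -- The data attached to `a`: the primes removed, the primes inserted, and the common factor `e`.
  set T : (ι → Finset ℕ) → Finset ((ι → Finset ℕ) × (ι → Finset ℕ) × ℕ) := fun a =>
    (Fintype.piFinset fun i => (a i).powersetCard j) ×ˢ
      ((Fintype.piFinset fun i => (Q i \ a i).powersetCard j) ×ˢ E) with hT
  have hFmem : ∀ a, a ∈ F ↔ ∀ i, a i ⊆ Q i ∧ (a i).card = J := by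
    intro a; simp [hF, Fintype.mem_piFinset, mem_powersetCard]
  have hTcard : ∀ a ∈ F, (T a).card =
      (∏ i, J.choose j * ((Q i).card - J).choose j) * E.card := by
    intro a ha
    rw [hFmem] at ha
    simp only [hT, card_product, Fintype.card_piFinset, card_powersetCard]
    rw [← mul_assoc, ← prod_mul_distrib]
    congr 1
    refine prod_congr rfl fun i _ => ?_
    rw [card_sdiff_of_subset (ha i).1, (ha i).2]
  have hsig : (F.sigma T).card =
      F.card * ((∏ i, J.choose j * ((Q i).card - J).choose j) * E.card) := by
    rw [card_sigma, sum_congr rfl hTcard, sum_const, smul_eq_mul]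
  rw [← hsig]
  have hTmem : ∀ a t, t ∈ T a ↔ (∀ i, t.1 i ⊆ a i ∧ (t.1 i).card = j) ∧
      (∀ i, t.2.1 i ⊆ Q i \ a i ∧ (t.2.1 i).card = j) ∧ t.2.2 ∈ E := by
    intro a t
    simp [hT, mem_product, Fintype.mem_piFinset, mem_powersetCard]
  have hpos : ∀ c : ι → Finset ℕ, (∀ i, c i ⊆ Q i) → 0 < val c := fun c hc =>
    prod_pos fun i _ => prod_pos fun p hp => (hprime i p (hc i hp)).pos
  have hle : ∀ c : ι → Finset ℕ, (∀ i, c i ⊆ Q i) → (∀ i, (c i).card = j) →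
      val c ≤ ∏ i, U i ^ j := fun c hc hcj =>
    prod_le_prod' fun i _ => (hcj i) ▸ prod_le_pow_card _ _ _ fun p hp => hU i p (hc i hp)
  have hco : ∀ c : ι → Finset ℕ, (∀ i, c i ⊆ Q i) → (val c).Coprime q := fun c hc =>
    Nat.Coprime.prod_left fun i _ => Nat.Coprime.prod_left fun p hp => hcop i p (hc i hp)
  have hmemI : ∀ e ∈ E, ∀ c : ι → Finset ℕ, (∀ i, c i ⊆ Q i) → (∀ i, (c i).card = j) →
      e * val c ∈ (Icc 1 N).filter (Nat.Coprime · q) := by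
    intro e he c hc hcj
    rw [mem_filter, mem_Icc]
    exact ⟨⟨Nat.mul_pos (hE e he).1 (hpos c hc),
      (Nat.mul_le_mul (hE e he).2.2 (hle c hc hcj)).trans hN⟩,
      Nat.Coprime.mul_left (hE e he).2.1 (hco c hc)⟩
  set sw : (ι → Finset ℕ) → (ι → Finset ℕ) × (ι → Finset ℕ) × ℕ → (ι → Finset ℕ) :=
    fun a t i => (a i \ t.1 i) ∪ t.2.1 i with hsw
  have hswF : ∀ a ∈ F, ∀ t ∈ T a, sw a t ∈ F := by
    intro a ha t ht
    rw [hFmem] at ha ⊢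
    rw [hTmem] at ht
    intro i
    refine ⟨union_subset (sdiff_subset.trans (ha i).1) ((ht.2.1 i).1.trans sdiff_subset), ?_⟩
    have hd : Disjoint (a i \ t.1 i) (t.2.1 i) :=
      disjoint_of_subset_left sdiff_subset
        (disjoint_of_subset_right (ht.2.1 i).1 disjoint_sdiff)
    rw [hsw]
    simp only
    rw [card_union_of_disjoint hd, card_sdiff_of_subset (ht.1 i).1, (ha i).2, (ht.1 i).2,
      (ht.2.1 i).2]
    have := card_le_card (ht.1 i).1
    rw [(ha i).2, (ht.1 i).2] at this
    omega
  have hswval : ∀ a ∈ F, ∀ t ∈ T a, val t.2.1 * val a = val t.1 * val (sw a t) := by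
    intro a ha t ht
    rw [hFmem] at ha
    rw [hTmem] at ht
    simp only [hval, ← prod_mul_distrib]
    refine prod_congr rfl fun i _ => ?_
    have hd : Disjoint (a i \ t.1 i) (t.2.1 i) :=
      disjoint_of_subset_left sdiff_subset
        (disjoint_of_subset_right (ht.2.1 i).1 disjoint_sdiff)
    rw [hsw]
    simp only
    rw [prod_union hd, ← mul_assoc, mul_comm (∏ p ∈ t.1 i, p), prod_sdiff (ht.1 i).1, mul_comm]
  have hTsub : ∀ a ∈ F, ∀ t ∈ T a, (∀ i, t.1 i ⊆ Q i) ∧ (∀ i, t.2.1 i ⊆ Q i) := by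
    intro a ha t ht
    rw [hFmem] at ha
    rw [hTmem] at ht
    exact ⟨fun i => (ht.1 i).1.trans (ha i).1, fun i => (ht.2.1 i).1.trans sdiff_subset⟩
  -- Inserted primes lie outside `a`, so `a` and its exchanged version determine both the removed
  -- and the inserted primes.
  have hrec : ∀ a t, t ∈ T a → (∀ i, t.1 i = a i \ sw a t i) ∧ ∀ i, t.2.1 i = sw a t i \ a i := by
    intro a t ht
    rw [hTmem] at ht
    constructor <;> intro i <;> ext p
    · have h1 := @(ht.1 i).1 p
      have h2 := @(ht.2.1 i).1 p
      simp only [hsw, mem_sdiff, mem_union] at h2 ⊢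
      tauto
    · have h1 := @(ht.1 i).1 p
      have h2 := @(ht.2.1 i).1 p
      simp only [hsw, mem_sdiff, mem_union] at h2 ⊢
      tauto
  -- The solution is `m = e · inserted`, `n = e · removed`, with `b` the exchanged `a`. Unique
  -- factorization recovers `a` and `b`, hence the exchange, and cancellation then recovers `e`.
  refine card_le_card_of_injOn
    (fun s : (_ : ι → Finset ℕ) × ((ι → Finset ℕ) × (ι → Finset ℕ) × ℕ) =>
      ((s.2.2.2 * val s.2.2.1, val s.1), (s.2.2.2 * val s.2.1, val (sw s.1 s.2)))) ?_ ?_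
  · rintro ⟨a, t⟩ hs
    rw [mem_coe, mem_sigma] at hs
    obtain ⟨ha, ht⟩ := hs
    have hsub := hTsub a ha t ht
    have ht' := (hTmem a t).1 ht
    rw [mem_coe, mem_filter, mem_product, mem_product, mem_product]
    refine ⟨⟨⟨hmemI _ ht'.2.2 _ hsub.2 fun i => (ht'.2.1 i).2, mem_image_of_mem _ ha⟩,
      hmemI _ ht'.2.2 _ hsub.1 fun i => (ht'.1 i).2, mem_image_of_mem _ (hswF a ha t ht)⟩, ?_⟩
    simp only
    rw [mul_assoc, mul_assoc, hswval a ha t ht]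
  · rintro ⟨a, t⟩ hs ⟨a', t'⟩ hs' heq
    rw [mem_coe, mem_sigma] at hs hs'
    obtain ⟨ha, ht⟩ := hs
    obtain ⟨ha', ht'⟩ := hs'
    simp only [Prod.mk.injEq] at heq ha ht ha' ht'
    obtain ⟨⟨h1, h2⟩, h3, h4⟩ := heq
    have hsubF : ∀ c ∈ F, ∀ i, c i ⊆ Q i := fun c hc i => ((hFmem c).1 hc i).1
    obtain rfl : a = a' := eq_of_prod_prod_eq hprime hdisj (hsubF a ha) (hsubF a' ha') h2
    have hb : sw a t = sw a t' := eq_of_prod_prod_eq hprime hdisj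
      (hsubF _ (hswF a ha t ht)) (hsubF _ (hswF a ha' t' ht')) h4
    have e1 : t.1 = t'.1 := funext fun i => by
      rw [(hrec a t ht).1 i, (hrec a t' ht').1 i, hb]
    have e2 : t.2.1 = t'.2.1 := funext fun i => by
      rw [(hrec a t ht).2 i, (hrec a t' ht').2 i, hb]
    have e3 : t.2.2 = t'.2.2 := by
      rw [e2] at h1
      exact Nat.eq_of_mul_eq_mul_right (hpos _ (hTsub a ha' t' ht').2) h1
    congr 1
    exact Prod.ext e1 (Prod.ext e2 e3)

/-! ### The resonance bound with free parameters. -/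

theorem mem_primeBlock {q s p : ℕ} :
    p ∈ primeBlock q s ↔ (4 ^ s < p ∧ p ≤ 4 ^ (s + 1)) ∧ p.Prime ∧ ¬ p ∣ q := by
  simp [primeBlock]

theorem coprime_of_mem_primeBlock {q s p : ℕ} (hp : p ∈ primeBlock q s) : p.Coprime q :=
  have h := (mem_primeBlock.1 hp).2
  (Nat.Prime.coprime_iff_not_dvd h.1).2 h.2

theorem disjoint_primeBlock {q s t : ℕ} (h : s ≠ t) :
    Disjoint (primeBlock q s) (primeBlock q t) := by
  wlog hst : s < t generalizing s t
  · exact (this h.symm (by omega)).symm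
  rw [Finset.disjoint_left]
  intro p hs ht
  have h1 := (mem_primeBlock.1 hs).1.2
  have h2 := (mem_primeBlock.1 ht).1.1
  have : 4 ^ (s + 1) ≤ 4 ^ t := Nat.pow_le_pow_right (by norm_num) hst
  omega

/-- Both binomials are bounded by `(m / j) ^ j ≤ C(m, j)`, with `n - J ≥ n / 2 ≥ 4 ^ (s + 1) / (16
H)`. The power of `4 ^ (s + 1)` split off bounds the product of `j` primes of the block; the other
factor is the gain over the trivial size. -/
theorem swap_count_ge {J j n s H : ℕ} (hj : 1 ≤ j) (hjJ : j ≤ J) (hJ : 2 * J ≤ n)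
    (hn : (4 : ℝ) ^ s / (2 * (s + 1)) ≤ n) (hH : s + 1 ≤ H) :
    ((4 ^ (s + 1)) ^ j : ℝ) * ((J : ℝ) / (16 * H * j ^ 2)) ^ j ≤
      (J.choose j * (n - J).choose j : ℕ) := by
  have hj0 : (0 : ℝ) < j := by exact_mod_cast hj
  have hH0 : (0 : ℝ) < H := by exact_mod_cast (by omega : 0 < H)
  have hHs : (s : ℝ) + 1 ≤ H := by exact_mod_cast hH
  have key : ∀ m : ℕ, j ≤ m → ((m : ℝ) / j) ^ j ≤ m.choose j := by
    intro m hm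
    rw [div_pow, div_le_iff₀ (by positivity), mul_comm]
    exact_mod_cast pow_le_pow_mul_choose hm
  have h1 := key J hjJ
  have h2 := key (n - J) (by omega)
  have h3 : (4 : ℝ) ^ s / (4 * H) ≤ ((n - J : ℕ) : ℝ) := by
    have hJn : (n : ℝ) ≤ 2 * ((n - J : ℕ) : ℝ) := by
      exact_mod_cast (by omega : n ≤ 2 * (n - J))
    have h4 : (4 : ℝ) ^ s / (4 * H) ≤ (4 : ℝ) ^ s / (2 * (s + 1)) / 2 := by
      rw [div_div]
      exact div_le_div_of_nonneg_left (by positivity) (by positivity) (by linarith)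
    linarith
  push_cast
  calc ((4 ^ (s + 1)) ^ j : ℝ) * ((J : ℝ) / (16 * H * j ^ 2)) ^ j
      = ((J : ℝ) / j) ^ j * ((4 : ℝ) ^ s / (4 * H) / j) ^ j := by
        rw [← mul_pow, ← mul_pow, pow_succ]
        congr 1
        field_simp
        ring
    _ ≤ ((J : ℝ) / j) ^ j * (((n - J : ℕ) : ℝ) / j) ^ j := by gcongr
    _ ≤ _ := by gcongr

open Finset in
/-- The resonance method with resonator supported on products of primes from the `W` blocks
`primeBlock q (S + i)`, each contributing `J` primes. -/
theorem exists_lt_normSq_sum {q : ℕ} [NeZero q] {S W J j r H N : ℕ} {x V : ℝ}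
    (hS : 8 ≤ S) (hr : 8 ≤ r) (hqS : Real.log q ≤ 2 ^ S) (hqr : Real.log q ≤ 2 ^ r)
    (hJ : J ≤ 2 ^ S) (hj : 1 ≤ j) (hjJ : j ≤ J) (hH : S + W ≤ H) (hBq : 4 ^ (H * J * W) < q)
    (hN : 4 ^ (r + 1) * ∏ i : Fin W, (4 ^ (S + i + 1)) ^ j ≤ N)
    (hx : x ≤ 4 ^ (r + 2) * ∏ i : Fin W, ((4 : ℝ) ^ (S + i + 1)) ^ j)
    (hV0 : 0 ≤ V)
    (hV : V + (N : ℝ) ^ 2 * 4 ^ (H * J * W) / q.totient <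
      x / (32 * (r + 1)) * ((J : ℝ) / (16 * H * j ^ 2)) ^ (j * W)) :
    ∃ χ : DirichletCharacter ℂ q, χ ≠ 1 ∧ V < ‖∑ n ∈ Icc 1 N, χ (n : ZMod q)‖ ^ 2 := by
  by_contra! hcon
  have hq0 : q ≠ 0 := NeZero.ne q
  have hφ : (0 : ℝ) < q.totient := by
    exact_mod_cast Nat.totient_pos.2 (Nat.pos_of_ne_zero hq0)
  set Q : Fin W → Finset ℕ := fun i => primeBlock q (S + i) with hQ
  set D : ℝ := ∏ i : Fin W, ((4 : ℝ) ^ (S + i + 1)) ^ j with hD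
  set F := Fintype.piFinset fun i => (Q i).powersetCard J with hF
  set A := F.image fun a => ∏ i, ∏ p ∈ a i, p with hA
  have hprime : ∀ i, ∀ p ∈ Q i, p.Prime := fun i p hp => (mem_primeBlock.1 hp).2.1
  have hdisj : Pairwise fun i k => Disjoint (Q i) (Q k) := fun i k hik =>
    disjoint_primeBlock fun h => hik (Fin.ext (by omega))
  have hcop : ∀ i, ∀ p ∈ Q i, p.Coprime q := fun i p hp => coprime_of_mem_primeBlock hp
  have hcard : ∀ i : Fin W, (4 : ℝ) ^ (S + i : ℕ) / (2 * ((S + i : ℕ) + 1)) ≤ ((Q i).card : ℝ) ∧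
      2 * J ≤ (Q i).card := by
    intro i
    have hmono : 2 ^ S ≤ 2 ^ (S + i : ℕ) := Nat.pow_le_pow_right (by norm_num) (by omega)
    have hmono' : (2 : ℝ) ^ S ≤ 2 ^ (S + i : ℕ) := by exact_mod_cast hmono
    have := primeBlock_card (s := S + i) hq0 (by omega) (hqS.trans hmono')
    refine ⟨this.1, le_trans ?_ this.2⟩
    rw [pow_succ]; omega
  have hFcard : A.card = F.card := by
    refine card_image_of_injOn fun a ha b hb h => ?_
    rw [mem_coe, hF, Fintype.mem_piFinset] at ha hb
    exact eq_of_prod_prod_eq hprime hdisj (fun i => (mem_powersetCard.1 (ha i)).1)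
      (fun i => (mem_powersetCard.1 (hb i)).1) h
  have hAprop : ∀ a ∈ A, (0 < a ∧ a ≤ 4 ^ (H * J * W)) ∧ a.Coprime q := by
    intro a ha
    obtain ⟨c, hc, rfl⟩ := mem_image.1 ha
    rw [hF, Fintype.mem_piFinset] at hc
    have hsub : ∀ i, ∀ p ∈ c i, p ∈ Q i := fun i p hp => (mem_powersetCard.1 (hc i)).1 hp
    refine ⟨⟨prod_pos fun i _ => prod_pos fun p hp => (hprime i p (hsub i p hp)).pos, ?_⟩,
      Nat.Coprime.prod_left fun i _ => Nat.Coprime.prod_left fun p hp => hcop i p (hsub i p hp)⟩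
    calc ∏ i, ∏ p ∈ c i, p ≤ ∏ i : Fin W, 4 ^ (H * J) := by
          refine prod_le_prod' fun i _ => ?_
          rw [pow_mul, ← (mem_powersetCard.1 (hc i)).2]
          refine prod_le_pow_card _ _ _ fun p hp => ?_
          exact (mem_primeBlock.1 (hsub i p hp)).1.2.trans
            (Nat.pow_le_pow_right (by norm_num) (by omega))
      _ = 4 ^ (H * J * W) := by rw [prod_const, card_univ, Fintype.card_fin, ← pow_mul]
  have hAcard : A.card ≤ 4 ^ (H * J * W) := by
    have : A ⊆ Icc 1 (4 ^ (H * J * W)) := fun a ha => mem_Icc.2 (hAprop a ha).1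
    simpa using card_le_card this
  have hFpos : 0 < F.card := by
    rw [hF, Fintype.card_piFinset]
    refine prod_pos fun i _ => ?_
    rw [card_powersetCard]
    exact Nat.choose_pos (by have := (hcard i).2; omega)
  have hres := totient_mul_card_le_of_sum_le N A
    (fun a ha => ⟨(hAprop a ha).2, lt_of_le_of_lt (hAprop a ha).1.2 hBq⟩) hV0 hcon
  have hcount := card_le_card_solutions (J := J) (j := j) (U := fun i : Fin W => 4 ^ (S + i + 1))
    (E := primeBlock q r) (X := 4 ^ (r + 1)) hprime hdisj hcop
    (fun i p hp => (mem_primeBlock.1 hp).1.2)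
    (fun e he => ⟨(mem_primeBlock.1 he).2.1.pos, coprime_of_mem_primeBlock he,
      (mem_primeBlock.1 he).1.2⟩) hN
  have hprod : D * ((J : ℝ) / (16 * H * j ^ 2)) ^ (j * W) ≤
      ((∏ i, J.choose j * ((Q i).card - J).choose j : ℕ) : ℝ) := by
    have : ((J : ℝ) / (16 * H * j ^ 2)) ^ (j * W) =
        ∏ i : Fin W, ((J : ℝ) / (16 * H * j ^ 2)) ^ j := by
      rw [prod_const, card_univ, Fintype.card_fin, pow_mul]
    rw [this, hD, ← prod_mul_distrib, Nat.cast_prod]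
    refine prod_le_prod (fun i _ => by positivity) fun i _ => ?_
    refine swap_count_ge hj hjJ (hcard i).2 ?_ (by omega)
    exact (hcard i).1
  have hE := (primeBlock_card hq0 hr hqr).1
  set g : ℝ := ((J : ℝ) / (16 * H * j ^ 2)) ^ (j * W) with hg
  have hg0 : 0 ≤ g := by positivity
  have hD0 : 0 ≤ D := by positivity
  have hlow : x / (32 * (r + 1)) * g ≤
      ((∏ i, J.choose j * ((Q i).card - J).choose j : ℕ) : ℝ) * ((primeBlock q r).card : ℝ) := by
    -- `32 = 2 · 4 ^ 2`: the denominator of the block count times the loss from `4 ^ (r + 2)` to `4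
    -- ^ r`.
    calc x / (32 * (r + 1)) * g ≤ (4 ^ (r + 2) * D) / (32 * (r + 1)) * g := by gcongr
      _ = (D * g) * ((4 : ℝ) ^ r / (2 * (r + 1))) := by
        rw [pow_add]; field_simp; ring
      _ ≤ _ := by gcongr
  rw [← hFcard] at hcount
  have hcount' := (Nat.cast_le (α := ℝ)).2 hcount
  rw [Nat.cast_mul, Nat.cast_mul] at hcount'
  rw [← hFcard] at hFpos
  have hApos : (0 : ℝ) < A.card := by exact_mod_cast hFpos
  have hAcard' : (A.card : ℝ) ≤ 4 ^ (H * J * W) := by exact_mod_cast hAcard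
  have hchain : (q.totient : ℝ) * (A.card * (x / (32 * (r + 1)) * g)) ≤
      V * (q.totient * A.card) + (N : ℝ) ^ 2 * (A.card : ℝ) ^ 2 := by
    refine le_trans ?_ hres
    refine mul_le_mul_of_nonneg_left (le_trans ?_ hcount') hφ.le
    gcongr
  have hfinal : (q.totient : ℝ) * A.card * (x / (32 * (r + 1)) * g) ≤
      (q.totient : ℝ) * A.card * (V + (N : ℝ) ^ 2 * 4 ^ (H * J * W) / q.totient) := by
    calc _ ≤ V * (q.totient * A.card) + (N : ℝ) ^ 2 * (A.card : ℝ) ^ 2 := by linarith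
      _ = (q.totient : ℝ) * A.card * (V + (N : ℝ) ^ 2 * A.card / q.totient) := by
        field_simp
      _ ≤ _ := by gcongr
  exact absurd (le_of_mul_le_mul_left hfinal (by positivity)) (not_le.2 hV)

/-! ### Sizes of the parameters in the limiting regime. -/

theorem log_le_half_self {y : ℝ} (hy : 0 < y) : Real.log y ≤ y / 2 := by
  have h1 : Real.log y = 2 * Real.log (√y) := by rw [Real.log_sqrt hy.le]; ring
  have h2 := Real.log_le_sub_one_of_pos (Real.sqrt_pos.2 hy)
  nlinarith [Real.sq_sqrt hy.le, sq_nonneg (√y - 2)]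

/-- The shape of the parameters in the limiting regime: with `L = log q / log x`,
`u = theoremBase q x` and `ℓ = log (log q)`, one has `log x = u ^ 2 * L * ℓ`. -/
theorem regime_parameters {q : ℕ} {x M : ℝ} (hM : 10 ^ 20 ≤ M)
    (hL : M ≤ Real.log q / Real.log x) (hu : M ≤ theoremBase q x) :
    20 ≤ Real.log (Real.log q) ∧
    Real.log x = theoremBase q x ^ 2 * (Real.log q / Real.log x) * Real.log (Real.log q) ∧
    Real.log q = (Real.log q / Real.log x) * Real.log x ∧
    Real.log (Real.log q) ≤
      4 * (Real.log (Real.log q / Real.log x) + Real.log (theoremBase q x)) := by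
  have hq0 : 0 ≤ Real.log (q : ℝ) := Real.log_natCast_nonneg q
  have hL0 : 0 < Real.log q / Real.log x := by linarith
  have hu0 : 0 < theoremBase q x := by linarith
  have hT0 : 0 < Real.log x := by
    by_contra! h
    exact absurd (div_nonpos_of_nonneg_of_nonpos hq0 h) (not_le.2 hL0)
  have hΛ : Real.log q = (Real.log q / Real.log x) * Real.log x := by field_simp
  have hΛ0 : 0 < Real.log q := by rw [hΛ]; positivity
  -- A nonpositive radicand would make the square root and the quotient `0`, so positivity of
  -- `theoremBase` forces `log log q > 0`.
  have hsq0 : 0 < √(Real.log q * Real.log (Real.log q)) := by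
    unfold theoremBase at hu0
    by_contra! h
    exact absurd (div_nonpos_of_nonneg_of_nonpos hT0.le h) (not_le.2 hu0)
  have hprod : 0 < Real.log q * Real.log (Real.log q) := Real.sqrt_pos.1 hsq0
  have hℓ0 : 0 < Real.log (Real.log q) := pos_of_mul_pos_right hprod hΛ0.le
  have hT : Real.log x = theoremBase q x * √(Real.log q * Real.log (Real.log q)) := by
    unfold theoremBase; field_simp
  have hT2 : Real.log x ^ 2 =
      theoremBase q x ^ 2 * (Real.log q * Real.log (Real.log q)) := by
    conv_lhs => rw [hT]
    rw [mul_pow, Real.sq_sqrt hprod.le]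
  generalize theoremBase q x = u at *
  generalize hLdef : Real.log q / Real.log x = L at *
  generalize Real.log x = T at *
  have hT3 : T = u ^ 2 * L * Real.log (Real.log q) := by
    have : T * T = T * (u ^ 2 * L * Real.log (Real.log q)) := by
      calc T * T = T ^ 2 := by ring
        _ = u ^ 2 * (L * T * Real.log (Real.log q)) := by rw [hT2]; rw [← hΛ]
        _ = _ := by ring
    exact mul_left_cancel₀ hT0.ne' this
  have hΛ2 : Real.log q = L ^ 2 * u ^ 2 * Real.log (Real.log q) := by
    rw [hΛ, ← hΛ]; nth_rewrite 1 [hΛ]; rw [hT3]; ring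
  -- A bootstrap: `q ≥ 3` gives only `ℓ ≥ 0.08`, but then `log q = L² u² ℓ` is at least `10 ^ 20`,
  -- whence `ℓ ≥ 20`.
  have hq3 : 3 ≤ q := by
    by_contra! h
    have h2 : Real.log q ≤ Real.log 2 := by
      rcases Nat.eq_zero_or_pos q with rfl | hq
      · simp at hΛ0
      · exact Real.log_le_log (by exact_mod_cast hq) (by exact_mod_cast (by omega : q ≤ 2))
    have h1 : Real.log q < 1 := by linarith [Real.log_two_lt_d9]
    exact absurd (Real.log_neg hΛ0 h1) (not_lt.2 hℓ0.le)
  have hlog3 : (1.089 : ℝ) ≤ Real.log q := by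
    have h3 : Real.log 3 ≤ Real.log q := Real.log_le_log (by norm_num) (by exact_mod_cast hq3)
    have h4 : Real.log ((2 : ℝ) ^ 11) ≤ Real.log ((3 : ℝ) ^ 7) :=
      Real.log_le_log (by norm_num) (by norm_num)
    rw [Real.log_pow, Real.log_pow] at h4
    push_cast at h4
    linarith [Real.log_two_gt_d9]
  have hℓ1 : (0.08 : ℝ) ≤ Real.log (Real.log q) := by
    have := Real.one_sub_inv_le_log_of_pos hΛ0
    have h5 : (Real.log q)⁻¹ ≤ (1.089 : ℝ)⁻¹ := inv_anti₀ (by norm_num) hlog3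
    norm_num at h5 ⊢
    linarith
  have hL20 : (10 : ℝ) ^ 20 ≤ L := hM.trans hL
  have hu20 : (10 : ℝ) ^ 20 ≤ u := hM.trans hu
  have hbig : (10 : ℝ) ^ 20 ≤ Real.log q := by
    rw [hΛ2]
    calc (10 : ℝ) ^ 20 ≤ (10 ^ 20) ^ 2 * (10 ^ 20) ^ 2 * 0.08 := by norm_num
      _ ≤ _ := by gcongr
  refine ⟨?_, hT3, hΛ, ?_⟩
  · rw [Real.le_log_iff_exp_le hΛ0]
    refine le_trans ?_ hbig
    have : Real.exp 20 = Real.exp 1 ^ 20 := by rw [← Real.exp_nat_mul]; norm_num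
    rw [this]
    exact pow_le_pow_left₀ (Real.exp_pos 1).le (by linarith [Real.exp_one_lt_d9]) 20
  · have h6 : Real.log (Real.log q) =
        2 * Real.log L + 2 * Real.log u + Real.log (Real.log (Real.log q)) := by
      conv_lhs => rw [hΛ2]
      rw [Real.log_mul (by positivity) hℓ0.ne', Real.log_mul (by positivity) (by positivity),
        Real.log_pow, Real.log_pow]
      push_cast; ring
    have := log_le_half_self hℓ0
    linarith

/-- The number of blocks used in the resonator. -/
theorem exists_block_number {L u ℓ : ℝ} (hL : 10 ^ 20 ≤ L) (hu : 10 ^ 20 ≤ u) (hℓ : 20 ≤ ℓ)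
    (hle : ℓ ≤ 4 * (Real.log L + Real.log u)) :
    ∃ W : ℕ, 1 ≤ W ∧ (W : ℝ) ≤ L ∧ (W : ℝ) ≤ ℓ ∧ 27648 * ℓ ≤ √u * W := by
  have hu0 : 0 < u := by linarith
  have hv : (10 : ℝ) ^ 10 ≤ √u := by
    rw [show (10 : ℝ) ^ 10 = √((10 ^ 10) ^ 2) from (Real.sqrt_sq (by norm_num)).symm]
    exact Real.sqrt_le_sqrt (le_trans (by norm_num) hu)
  have half : ∀ y : ℝ, 1 ≤ y → y / 2 ≤ (⌊y⌋₊ : ℝ) := by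
    intro y hy
    have h1 := Nat.lt_floor_add_one y
    have h2 : (1 : ℝ) ≤ ⌊y⌋₊ := by exact_mod_cast Nat.one_le_floor_iff y |>.2 hy
    linarith
  -- `W ≤ L` makes rounding in `j ≈ 2 L / W` cheap, and `W ≤ ℓ` keeps the block indices `O(ℓ)`. If
  -- `L` is the minimum, `ℓ ≤ 4 (log L + log u)` shows that `√u L` still dominates `ℓ`.
  refine ⟨min ⌊L⌋₊ ⌊ℓ⌋₊, ?_, ?_, ?_, ?_⟩
  · exact le_min ((Nat.one_le_floor_iff _).2 (by linarith)) ((Nat.one_le_floor_iff _).2 (by linarith))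
  · exact (Nat.cast_le.2 (min_le_left _ _)).trans (Nat.floor_le (by linarith))
  · exact (Nat.cast_le.2 (min_le_right _ _)).trans (Nat.floor_le (by linarith))
  · rw [Nat.cast_min]
    rcases min_choice (⌊L⌋₊ : ℝ) (⌊ℓ⌋₊ : ℝ) with h | h <;> rw [h]
    · have h1 := half L (by linarith)
      have h2 : Real.log L ≤ L := by
        linarith [log_le_half_self (by linarith : 0 < L)]
      have h3 : Real.log u ≤ √u := by
        have := log_le_half_self (Real.sqrt_pos.2 hu0)
        rw [Real.log_sqrt hu0.le] at this
        linarith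
      have h4 : 27648 * ℓ ≤ 110592 * (L + √u) := by linarith
      have h5 : √u * (L / 2) ≤ √u * ⌊L⌋₊ := by gcongr
      nlinarith
    · have h1 := half ℓ (by linarith)
      nlinarith

/-- The spare factor `u ^ L` absorbs `32 log x = 32 u² L ℓ`, as `64 u² L ℓ ≤ u⁴ L² < u ^ L`. -/
theorem final_gain {L u ℓ : ℝ} (hL : 10 ^ 20 ≤ L) (hu : 10 ^ 20 ≤ u) (hℓ : 20 ≤ ℓ)
    (hle : ℓ ≤ 4 * (Real.log L + Real.log u)) :
    u ^ (2 * L) + 1 < u ^ (3 * L) / (32 * (u ^ 2 * L * ℓ)) := by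
  have hu0 : 0 < u := by linarith
  have hL0 : 0 < L := by linarith
  have hlogu : 7 ≤ Real.log u := by
    rw [Real.le_log_iff_exp_le hu0]
    refine le_trans ?_ hu
    have : Real.exp 7 = Real.exp 1 ^ 7 := by rw [← Real.exp_nat_mul]; norm_num
    rw [this]
    calc Real.exp 1 ^ 7 ≤ 10 ^ 7 :=
          pow_le_pow_left₀ (Real.exp_pos 1).le (by linarith [Real.exp_one_lt_d9]) 7
      _ ≤ _ := by norm_num
  have hlogL : Real.log L ≤ L / 2 := log_le_half_self hL0
  have hlogu2 : Real.log u ≤ u / 2 := log_le_half_self hu0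
  have hT : 64 * (u ^ 2 * L * ℓ) ≤ u ^ 4 * L ^ 2 := by
    have h1 : ℓ ≤ 2 * (L + u) := by linarith
    have h2 : 128 * (L + u) ≤ u * L * u := by
      have h3 : L + u ≤ u * L := by nlinarith
      have h4 : 128 * (u * L) ≤ u * (u * L) :=
        mul_le_mul_of_nonneg_right (by linarith) (by positivity)
      linarith
    calc 64 * (u ^ 2 * L * ℓ) ≤ 64 * (u ^ 2 * L * (2 * (L + u))) := by gcongr
      _ = u ^ 2 * L * (128 * (L + u)) := by ring
      _ ≤ u ^ 2 * L * (u * L * u) := by gcongr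
      _ = _ := by ring
  have hpow : u ^ 4 * L ^ 2 < u ^ L := by
    rw [← Real.log_lt_log_iff (by positivity) (by positivity), Real.log_rpow hu0,
      Real.log_mul (by positivity) (by positivity), Real.log_pow, Real.log_pow]
    push_cast
    nlinarith
  have h2L : 1 ≤ u ^ (2 * L) := Real.one_le_rpow (by linarith) (by positivity)
  have h3 : u ^ (3 * L) = u ^ (2 * L) * u ^ L := by rw [← Real.rpow_add hu0]; ring_nf
  rw [lt_div_iff₀ (by positivity), h3]
  have hT0 : 0 < u ^ 2 * L * ℓ := by positivity
  nlinarith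

/-- Selects the block of the common prime `e`, which fills the room between the exchanged primes and
`N` up to a bounded factor. -/
theorem exists_four_pow_le_lt {D N : ℕ} (hD : 0 < D) (h : 4 * D ≤ N) :
    ∃ r : ℕ, 4 ^ (r + 1) * D ≤ N ∧ N < 4 ^ (r + 2) * D := by
  have h4 : 4 ≤ N / D := (Nat.le_div_iff_mul_le hD).2 h
  have hlog : 1 ≤ Nat.log 4 (N / D) := Nat.log_pos (by norm_num) h4
  refine ⟨Nat.log 4 (N / D) - 1, ?_, ?_⟩
  · rw [Nat.sub_add_cancel hlog]
    exact (Nat.le_div_iff_mul_le hD).1 (Nat.pow_log_le_self 4 (by omega))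
  · rw [show Nat.log 4 (N / D) - 1 + 2 = Nat.log 4 (N / D) + 1 by omega]
    exact (Nat.div_lt_iff_lt_mul hD).1 (Nat.lt_pow_succ_log_self (by norm_num) _)

theorem four_pow_le_exp {n : ℕ} {y : ℝ} (h : 1.4 * n ≤ y) : (4 : ℝ) ^ n ≤ Real.exp y := by
  have hlog4 : Real.log 4 ≤ 1.4 := by
    rw [show (4 : ℝ) = 2 ^ 2 by norm_num, Real.log_pow]
    push_cast
    linarith [Real.log_two_lt_d9]
  rw [← Real.log_le_iff_le_exp (by positivity), Real.log_pow]
  have : (0 : ℝ) ≤ n := Nat.cast_nonneg n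
  nlinarith

/-! ### Choice of the parameters and conclusion. -/

set_option maxHeartbeats 1000000 in
/-- In the limiting regime some non-principal character sum is as large as `u ^ L * √x`, where
`u = theoremBase q x` and `L = log q / log x`. -/
theorem exists_large_charSum {q : ℕ} {x : ℝ} (hx : 0 < x)
    (hL : 10 ^ 20 ≤ Real.log q / Real.log x) (hu : 10 ^ 20 ≤ theoremBase q x) :
    ∃ χ : DirichletCharacter ℂ q, χ ≠ 1 ∧
      theoremBase q x ^ (Real.log q / Real.log x) ≤ ‖charSum χ x‖ / √x := by
  obtain ⟨hℓ, hT, hΛ, hle⟩ := regime_parameters le_rfl hL hu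
  obtain ⟨W, hW1, hWL, hWℓ, hWu⟩ := exists_block_number hL hu hℓ hle
  have hgain := final_gain hL hu hℓ hle
  rw [← hT] at hgain
  set ℓ := Real.log (Real.log q) with hℓdef
  set L := Real.log q / Real.log x with hLdef
  set u := theoremBase q x with hudef
  set T := Real.log x with hTdef
  set Λ := Real.log (q : ℝ) with hΛdef
  clear_value Λ T u L ℓ
  have hL0 : 0 < L := by linarith
  have hu0 : 0 < u := by linarith
  have hℓ0 : 0 < ℓ := by linarith
  have hT0 : 0 < T := by rw [hT]; positivity
  have hΛ0 : 0 < Λ := by rw [hΛ]; positivity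
  have hq0 : q ≠ 0 := by rintro rfl; simp [hΛdef] at hΛ0
  have : NeZero q := ⟨hq0⟩
  have hqpos : (0 : ℝ) < q := by exact_mod_cast Nat.pos_of_ne_zero hq0
  have hexpℓ : Real.exp ℓ = Λ := hℓdef ▸ Real.exp_log hΛ0
  have hexpT : Real.exp T = x := hTdef ▸ Real.exp_log hx
  have hexpΛ : Real.exp Λ = q := hΛdef ▸ Real.exp_log hqpos
  have hΛ2 : Λ = L ^ 2 * u ^ 2 * ℓ := by rw [hΛ, hT]; ring
  have hW1' : (1 : ℝ) ≤ W := by exact_mod_cast hW1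
  have hW0 : (0 : ℝ) < W := by linarith
  -- Then `2 ^ S ≥ e ^ (1.38 ℓ) ≥ log q`, as the block estimates require.
  set S := ⌈2 * ℓ⌉₊ with hSdef
  have hSlow : 2 * ℓ ≤ S := Nat.le_ceil _
  have hSup : (S : ℝ) < 2 * ℓ + 1 := Nat.ceil_lt_add_one (by positivity)
  clear_value S
  have hS8 : 8 ≤ S := by exact_mod_cast (by linarith : (8 : ℝ) ≤ S)
  have htwo : ∀ n : ℕ, Real.exp (n * 0.69) ≤ 2 ^ n := by
    intro n
    rw [Real.exp_nat_mul]
    refine pow_le_pow_left₀ (Real.exp_pos _).le ?_ n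
    rw [← Real.le_log_iff_exp_le (by norm_num)]
    linarith [Real.log_two_gt_d9]
  have hΛS : Λ ≤ 2 ^ S := by
    refine le_trans ?_ (htwo S)
    rw [← hexpℓ]
    exact Real.exp_le_exp.2 (by linarith)
  set H := S + W with hHdef
  have hH : (H : ℝ) ≤ 4 * ℓ := by rw [hHdef]; push_cast; linarith
  have hH0 : (0 : ℝ) < H := by rw [hHdef]; push_cast; linarith
  -- The least `j` with `j W ≥ 2 L`; since `W ≤ L`, rounding keeps `j W ≤ 3 L`.
  set j := ⌈2 * L / W⌉₊ with hjdef
  have hjlow : 2 * L / W ≤ j := Nat.le_ceil _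
  have hLW : 1 ≤ L / W := by rwa [one_le_div hW0]
  have hjup : (j : ℝ) ≤ 3 * L / W := by
    have h1 : (j : ℝ) < 2 * L / W + 1 := Nat.ceil_lt_add_one (by positivity)
    have h2 : 3 * L / W = 2 * L / W + L / W := by ring
    linarith
  clear_value j
  have hj0 : (0 : ℝ) < j := lt_of_lt_of_le (by positivity) hjlow
  have hj1 : 1 ≤ j := by exact_mod_cast hj0
  have hjW : 2 * L ≤ (j * W : ℕ) := by
    push_cast; exact (div_le_iff₀ hW0).1 hjlow
  have hjW' : (j : ℝ) * W ≤ 3 * L := (le_div_iff₀ hW0).1 hjup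
  -- With `H ≤ 4 ℓ` and `log 4 ≤ 1.4`, the constant `24` gives `H J W log 4 ≤ (1.4 / 6) log q`, so
  -- the resonator stays below `q ^ (1/4)`.
  set J := ⌊Λ / (24 * W * ℓ)⌋₊ with hJdef
  have hJup : (J : ℝ) ≤ Λ / (24 * W * ℓ) := Nat.floor_le (by positivity)
  have hJeq : Λ / (24 * W * ℓ) = (L / W) * (L * u ^ 2 / 24) := by rw [hΛ2]; field_simp
  have hLu : 10 ^ 20 * 10 ^ 20 ≤ L * u ^ 2 := by
    have : (10 : ℝ) ^ 20 ≤ u ^ 2 := by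
      calc (10 : ℝ) ^ 20 ≤ (10 ^ 20) ^ 2 := by norm_num
        _ ≤ u ^ 2 := by gcongr
    gcongr
  have hJfl : Λ / (24 * W * ℓ) < J + 1 := Nat.lt_floor_add_one _
  clear_value J
  have hJbig : 10 * (L / W) ≤ Λ / (24 * W * ℓ) := by
    rw [hJeq, mul_comm]; gcongr; linarith
  have hJlow : Λ / (48 * W * ℓ) ≤ J := by
    have h2 : Λ / (48 * W * ℓ) = Λ / (24 * W * ℓ) / 2 := by field_simp; norm_num
    rw [h2]; linarith
  have hjJ : j ≤ J := by
    have h2 : 3 * L / W = 3 * (L / W) := by ring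
    exact_mod_cast (by linarith : (j : ℝ) ≤ J)
  have hJS : J ≤ 2 ^ S := by
    have h1 : Λ / (24 * W * ℓ) ≤ Λ := by
      refine div_le_self hΛ0.le ?_
      calc (1 : ℝ) ≤ 24 * 1 * 20 := by norm_num
        _ ≤ 24 * W * ℓ := by gcongr
    exact_mod_cast (by linarith : (J : ℝ) ≤ 2 ^ S)
  have hB : (4 : ℝ) ^ (H * J * W) ≤ Real.exp (Λ / 4) := by
    refine four_pow_le_exp ?_
    push_cast
    have h1 : (J : ℝ) * W ≤ Λ / (24 * ℓ) := by
      calc (J : ℝ) * W ≤ Λ / (24 * W * ℓ) * W := by gcongr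
        _ = _ := by field_simp
    calc 1.4 * ((H : ℝ) * J * W) = 1.4 * (H * (J * W)) := by ring
      _ ≤ 1.4 * (4 * ℓ * (Λ / (24 * ℓ))) := by gcongr
      _ = 1.4 / 6 * Λ := by field_simp; ring
      _ ≤ Λ / 4 := by linarith
  have hBq : 4 ^ (H * J * W) < q := by
    have : (4 : ℝ) ^ (H * J * W) < q := by
      rw [← hexpΛ]
      exact lt_of_le_of_lt hB (Real.exp_lt_exp.2 (by linarith))
    exact_mod_cast this
  set D : ℕ := ∏ i : Fin W, (4 ^ (S + i + 1)) ^ j with hDdef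
  have hDpos : 0 < D := Finset.prod_pos fun i _ => by positivity
  have hDle : (D : ℝ) ≤ Real.exp (17 * (L * ℓ)) := by
    have h1 : D ≤ 4 ^ (H * (j * W)) := by
      calc D ≤ ∏ _i : Fin W, (4 ^ H) ^ j := by
            refine Finset.prod_le_prod' fun i _ => ?_
            exact Nat.pow_le_pow_left (Nat.pow_le_pow_right (by norm_num) (by omega)) _
        _ = _ := by
            rw [Finset.prod_const, Finset.card_univ, Fintype.card_fin, ← pow_mul, ← pow_mul]
    have h2 : (D : ℝ) ≤ 4 ^ (H * (j * W)) := by exact_mod_cast h1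
    refine h2.trans (four_pow_le_exp ?_)
    push_cast
    calc 1.4 * ((H : ℝ) * (j * W)) ≤ 1.4 * (4 * ℓ * (3 * L)) := by gcongr
      _ = 16.8 * (L * ℓ) := by ring
      _ ≤ 17 * (L * ℓ) := by gcongr; norm_num
  set N := ⌊x⌋₊ with hNdef
  have hNx : (N : ℝ) ≤ x := Nat.floor_le hx.le
  have hxN : x < N + 1 := Nat.lt_floor_add_one x
  have hTlarge : 17 * (L * ℓ) + 100 * ℓ ≤ T := by
    have h1 : (10 : ℝ) ^ 20 ≤ u ^ 2 := by
      calc (10 : ℝ) ^ 20 ≤ (10 ^ 20) ^ 2 := by norm_num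
        _ ≤ u ^ 2 := by gcongr
    have h2 : 10 ^ 20 * (L * ℓ) ≤ u ^ 2 * (L * ℓ) := by gcongr
    have h3 : 100 * ℓ ≤ L * ℓ := by gcongr; linarith
    have h4 : 0 < L * ℓ := by positivity
    rw [hT]
    linarith
  have hxD : Real.exp (100 * ℓ) * D ≤ x := by
    calc Real.exp (100 * ℓ) * D ≤ Real.exp (100 * ℓ) * Real.exp (17 * (L * ℓ)) := by gcongr
      _ = Real.exp (17 * (L * ℓ) + 100 * ℓ) := by rw [← Real.exp_add, add_comm]
      _ ≤ Real.exp T := Real.exp_le_exp.2 hTlarge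
      _ = x := hexpT
  have h4D : 4 * D ≤ N := by
    refine Nat.le_floor ?_
    push_cast
    refine le_trans ?_ hxD
    gcongr
    linarith [Real.add_one_le_exp (100 * ℓ)]
  obtain ⟨r, hr1, hr2⟩ := exists_four_pow_le_lt hDpos h4D
  have hxr : x ≤ 4 ^ (r + 2) * (D : ℝ) := by
    have : (N : ℝ) + 1 ≤ 4 ^ (r + 2) * (D : ℝ) := by exact_mod_cast hr2
    linarith
  -- Since `4 ^ (r + 2) ≥ x / D ≥ e ^ (100 ℓ)`, one has `2 ^ (r + 2) ≥ (log q) ^ 50`, so block `r`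
  -- also meets the size conditions.
  have hr2' : 16 * Λ ≤ (2 : ℝ) ^ (r + 2) ∧ (2 : ℝ) ^ 10 ≤ 2 ^ (r + 2) := by
    have h1 : Real.exp (100 * ℓ) ≤ 4 ^ (r + 2) := by
      have : (0 : ℝ) < D := by exact_mod_cast hDpos
      exact le_of_mul_le_mul_right (hxD.trans hxr) this
    have h2 : Real.exp (50 * ℓ) ≤ 2 ^ (r + 2) := by
      refine (abs_le_of_sq_le_sq' ?_ (by positivity)).2
      have h5 : Real.exp (50 * ℓ) ^ 2 = Real.exp (100 * ℓ) := by
        rw [← Real.exp_nat_mul]; push_cast; ring_nf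
      have h6 : ((2 : ℝ) ^ (r + 2)) ^ 2 = 4 ^ (r + 2) := by
        rw [← pow_mul, mul_comm, pow_mul]; norm_num
      rw [h5, h6]
      exact h1
    have h3 : 980 ≤ Real.exp (49 * ℓ) := by
      linarith [Real.add_one_le_exp (49 * ℓ)]
    have h4 : Real.exp (50 * ℓ) = Real.exp (49 * ℓ) * Λ := by
      rw [← hexpℓ, ← Real.exp_add]; ring_nf
    have h5 : 21 ≤ Λ := by
      rw [← hexpℓ]; linarith [Real.add_one_le_exp ℓ]
    constructor
    · refine le_trans ?_ h2
      rw [h4]; gcongr; linarith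
    · refine le_trans ?_ h2
      rw [h4]
      calc (2 : ℝ) ^ 10 ≤ 980 * 21 := by norm_num
        _ ≤ Real.exp (49 * ℓ) * Λ := by gcongr
  have hr8 : 8 ≤ r := by
    have : 10 ≤ r + 2 := (pow_le_pow_iff_right₀ (by norm_num : (1 : ℝ) < 2)).1 hr2'.2
    omega
  have hΛr : Λ ≤ 2 ^ r := by
    have := hr2'.1
    rw [pow_add] at this
    linarith
  have hrT : (r : ℝ) + 1 ≤ T := by
    have h1 : (4 : ℝ) ^ (r + 1) ≤ x := by
      refine le_trans ?_ hNx
      have : 4 ^ (r + 1) ≤ N := le_trans (Nat.le_mul_of_pos_right _ hDpos) hr1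
      exact_mod_cast this
    have h2 := Real.log_le_log (by positivity) h1
    rw [Real.log_pow] at h2
    push_cast at h2
    have h3 : 1 ≤ Real.log 4 := by
      rw [show (4 : ℝ) = 2 ^ 2 by norm_num, Real.log_pow]
      push_cast
      linarith [Real.log_two_gt_d9]
    have h4 : ((r : ℝ) + 1) * 1 ≤ (r + 1) * Real.log 4 := by gcongr
    linarith
  -- The bounds on `J`, `H`, `j` give at least `u² W / (27648 ℓ)`, where `27648 = 48 · (16 · 4) · 3
  -- ^ 2`; the choice of `W` makes this at least `u ^ (3/2)`.
  have hbase : u ^ (3 / 2 : ℝ) ≤ (J : ℝ) / (16 * H * j ^ 2) := by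
    have h1 : u ^ (3 / 2 : ℝ) = u * √u := by
      rw [Real.sqrt_eq_rpow, show (3 / 2 : ℝ) = 1 + 1 / 2 by norm_num, Real.rpow_add hu0,
        Real.rpow_one]
    have h2 : u = √u * √u := (Real.mul_self_sqrt hu0.le).symm
    have h3 : √u ≤ u * W / (27648 * ℓ) := by
      rw [le_div_iff₀ (by positivity)]
      calc √u * (27648 * ℓ) ≤ √u * (√u * W) := by gcongr
        _ = u * W := by rw [← mul_assoc, ← h2]
    rw [h1]
    calc u * √u ≤ u * (u * W / (27648 * ℓ)) := by gcongr
      _ = (Λ / (48 * W * ℓ)) / (16 * (4 * ℓ) * (3 * L / W) ^ 2) := by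
        rw [hΛ2]; field_simp; norm_num
      _ ≤ _ := by gcongr
  have hpow : u ^ (3 * L) ≤ ((J : ℝ) / (16 * H * j ^ 2)) ^ (j * W) := by
    have hu1 : 1 ≤ u ^ (3 / 2 : ℝ) := Real.one_le_rpow (by linarith) (by norm_num)
    calc u ^ (3 * L) = (u ^ (3 / 2 : ℝ)) ^ (2 * L) := by rw [← Real.rpow_mul hu0.le]; ring_nf
      _ ≤ (u ^ (3 / 2 : ℝ)) ^ ((j * W : ℕ) : ℝ) := Real.rpow_le_rpow_of_exponent_le hu1 hjW
      _ = (u ^ (3 / 2 : ℝ)) ^ (j * W) := Real.rpow_natCast _ _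
      _ ≤ _ := by gcongr
  -- Here `x ≤ q ^ (1/100)` and `4 ^ (H J W) ≤ q ^ (1/4)`, so their product is below `√(q / 2) ≤
  -- φ(q)`.
  have hprincipal : (N : ℝ) ^ 2 * 4 ^ (H * J * W) / q.totient ≤ x := by
    have hφ : (0 : ℝ) < q.totient := by
      exact_mod_cast Nat.totient_pos.2 (Nat.pos_of_ne_zero hq0)
    have h1 : x * 4 ^ (H * J * W) ≤ q.totient := by
      have h2 : x * 4 ^ (H * J * W) ≤ Real.exp (T + Λ / 4) := by
        rw [Real.exp_add, hexpT]; gcongr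
      have h3 : Real.exp (T + Λ / 4) ^ 2 * 2 ≤ q := by
        rw [← hexpΛ, ← Real.exp_nat_mul]
        calc Real.exp ((2 : ℕ) * (T + Λ / 4)) * 2
            ≤ Real.exp ((2 : ℕ) * (T + Λ / 4)) * Real.exp 1 := by
              gcongr; linarith [Real.exp_one_gt_d9]
          _ = Real.exp (2 * T + Λ / 2 + 1) := by rw [← Real.exp_add]; push_cast; ring_nf
          _ ≤ Real.exp Λ := by
              refine Real.exp_le_exp.2 ?_
              have : 100 * T ≤ Λ := by rw [hΛ]; gcongr; linarith
              have : 0 < L * ℓ := by positivity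
              linarith
      have h4 : (q : ℝ) ≤ 2 * (q.totient : ℝ) ^ 2 := by exact_mod_cast le_two_mul_totient_sq q
      refine h2.trans (abs_le_of_sq_le_sq' (by linarith) hφ.le).2
    rw [div_le_iff₀ hφ]
    calc (N : ℝ) ^ 2 * 4 ^ (H * J * W) ≤ x ^ 2 * 4 ^ (H * J * W) := by gcongr
      _ = x * (x * 4 ^ (H * J * W)) := by ring
      _ ≤ _ := by gcongr
  obtain ⟨χ, hχ, hlt⟩ := exists_lt_normSq_sum (q := q) (x := x) (V := u ^ (2 * L) * x)
    hS8 hr8 (hΛdef ▸ hΛS) (hΛdef ▸ hΛr) hJS hj1 hjJ (le_refl H) hBq hr1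
    (by rw [hDdef] at hxr; push_cast at hxr; exact hxr) (by positivity) (by
      calc u ^ (2 * L) * x + (N : ℝ) ^ 2 * 4 ^ (H * J * W) / q.totient
          ≤ u ^ (2 * L) * x + x := by gcongr
        _ = x * (u ^ (2 * L) + 1) := by ring
        _ < x * (u ^ (3 * L) / (32 * T)) := by gcongr
        _ = x / (32 * T) * u ^ (3 * L) := by ring
        _ ≤ _ := by gcongr)
  refine ⟨χ, hχ, ?_⟩
  rw [le_div_iff₀ (Real.sqrt_pos.2 hx)]
  refine (abs_le_of_sq_le_sq' ?_ (norm_nonneg _)).2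
  rw [mul_pow, Real.sq_sqrt hx.le, ← Real.rpow_mul_natCast hu0.le]
  refine le_trans (le_of_eq ?_) hlt.le
  push_cast
  rw [mul_comm L 2]

/-- The resonance method gives more than the required bound, so the error exponent `δ` may be taken
to vanish identically. -/
theorem theorem6 :
    ∃ c : ℝ, 0 < c ∧ ∃ δ : ℕ × ℝ → ℝ, Filter.Tendsto δ largeRegime (nhds 0) ∧
      ∀ᶠ p : ℕ × ℝ in largeRegime, ∃ χ : DirichletCharacter ℂ p.1, χ ≠ 1 ∧
        c * theoremBase p.1 p.2 ^ ((1 + δ p) * (Real.log p.1 / Real.log p.2)) ≤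
          ‖charSum χ p.2‖ / Real.sqrt p.2 := by
  refine ⟨1, one_pos, fun _ => 0, tendsto_const_nhds, ?_⟩
  have h1 : ∀ᶠ p : ℕ × ℝ in largeRegime, (10 : ℝ) ^ 20 ≤ Real.log p.1 / Real.log p.2 :=
    Filter.Eventually.filter_mono (inf_le_left.trans inf_le_left)
      ((Filter.eventually_ge_atTop _).comap _)
  have h2 : ∀ᶠ p : ℕ × ℝ in largeRegime, (10 : ℝ) ^ 20 ≤ theoremBase p.1 p.2 :=
    Filter.Eventually.filter_mono (inf_le_left.trans inf_le_right)
      ((Filter.eventually_ge_atTop _).comap _)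
  have h3 : ∀ᶠ p : ℕ × ℝ in largeRegime, 0 < p.2 :=
    Filter.Eventually.filter_mono inf_le_right (Filter.mem_principal_self _)
  filter_upwards [h1, h2, h3] with p hp1 hp2 hp3
  obtain ⟨χ, hχ, h⟩ := exists_large_charSum hp3 hp1 hp2
  refine ⟨χ, hχ, ?_⟩
  rw [one_mul, add_zero, one_mul]
  exact h
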